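/- Let $H$ be a random $3\times 3$ GUE matrix, that is, a random complex Hermitian matrix whose diagonal entries are $N(0,1)$ variables and whose entries above the diagonal have real and imaginary parts which are $N(0,\tfrac12)$ variables, all of these real variables being independent (equivalently, $H$ has density proportional to $e^{-\frac12\operatorname{tr}(H^2)}$). Let $\phi_1\ge\phi_2\ge\phi_3$ be the ordered eigenvalues of $H$. Then the pair of consecutive spacings $(\alpha,\beta)=(\phi_1-\phi_2,\ \phi_2-\phi_3)$ has a joint density with respect to Lebesgue measure on $\{\alpha\ge 0,\ \beta\ge 0\}$ (and vanishing outside this set), namely $$\tilde C\,\alpha^2\beta^2(\alpha+\beta)^2\exp\!\Big(-\tfrac13\big(\alpha^2+\alpha\beta+\beta^2\big)\Big),$$ where the normalising constant $\tilde C$ is $0.046$ to three decimal places, i.e. $|\tilde C-0.046|<0.0005$. -/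

import Mathlib

open MeasureTheory ProbabilityTheory

noncomputable section

/-- The Hermitian matrix with real parameters `x`: the diagonal entries are `x (i, i)`, and for
`i < j` the `(i, j)` entry has real part `x (i, j)` and imaginary part `x (j, i)`. -/
def hermitianOfParams {n : ℕ} (x : Fin n × Fin n → ℝ) : Matrix (Fin n) (Fin n) ℂ :=
  Matrix.of fun i j =>
    if i = j then (x (i, i) : ℂ)
    else if i < j then (x (i, j) : ℂ) + (x (j, i) : ℂ) * Complex.I
    else (x (j, i) : ℂ) - (x (i, j) : ℂ) * Complex.I

theorem isHermitian_hermitianOfParams {n : ℕ} (x : Fin n × Fin n → ℝ) :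
    (hermitianOfParams x).IsHermitian := by
  ext i j
  rcases lt_trichotomy i j with h | h | h
  · simp [hermitianOfParams, h.ne, h.ne', h, h.not_gt, sub_eq_add_neg]
  · simp [hermitianOfParams, h]
  · simp [hermitianOfParams, h.ne, h.ne', h, h.not_gt, sub_eq_add_neg]

/-- Matrices carry the product (that is, entrywise) sigma-algebra. -/
instance Matrix.instMeasurableSpacePi {m n α : Type*} [MeasurableSpace α] :
    MeasurableSpace (Matrix m n α) :=
  inferInstanceAs (MeasurableSpace (m → n → α))

/-- The space of `n × n` complex Hermitian matrices. -/
abbrev HermitianMatrix (n : ℕ) : Type := {A : Matrix (Fin n) (Fin n) ℂ // A.IsHermitian}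

/-- The law of an `n × n` GUE matrix: the diagonal entries are `N(0, 1)`, the real and imaginary
parts of the entries above the diagonal are `N(0, 1/2)`, and all of these are independent.
Equivalently, the density is proportional to `exp (-tr(A²) / 2)`. -/
def gue (n : ℕ) : Measure (HermitianMatrix n) :=
  (Measure.pi fun p : Fin n × Fin n => gaussianReal 0 (if p.1 = p.2 then 1 else 1 / 2)).map
    fun x => ⟨hermitianOfParams x, isHermitian_hermitianOfParams x⟩

/-- The eigenvalues of a Hermitian matrix, with multiplicity, in decreasing order. -/
def orderedEigenvalue {n : ℕ} (A : HermitianMatrix n) (k : Fin n) : ℝ :=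
  A.2.eigenvalues₀ (Fin.cast (Fintype.card_fin n).symm k)

theorem orderedEigenvalue_antitone {n : ℕ} (A : HermitianMatrix n) :
    Antitone (orderedEigenvalue A) :=
  fun _ _ h => A.2.eigenvalues₀_antitone h

theorem measurable_hermitianOfParams (n : ℕ) :
    Measurable fun x : Fin n × Fin n → ℝ =>
      (⟨hermitianOfParams x, isHermitian_hermitianOfParams x⟩ : HermitianMatrix n) := by
  refine Measurable.subtype_mk (measurable_pi_lambda _ fun i => measurable_pi_lambda _ fun j => ?_)
  simp only [hermitianOfParams, Matrix.of_apply]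
  split_ifs <;> fun_prop

instance (n : ℕ) : IsProbabilityMeasure (gue n) :=
  Measure.isProbabilityMeasure_map (measurable_hermitianOfParams n).aemeasurable

end

/-!
The eigenvalue density of the `3 × 3` GUE is obtained by following the eigenvalues through the
nested lower right corners of the matrix, of sizes one, two and three.

The eigenvalues of a bordered matrix depend only on the corner entry `a`, the eigenvalues `μ` of
the block, and the squared moduli `B k` of the border in an eigenbasis of the block: the
characteristic polynomial is affine in `(a, B)` when `μ` is fixed. The Gaussian law of the border is
invariant under unitary changes of basis (`borderIntegral_eq_diagonal`), and the squared modulus of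
a standard complex Gaussian is exponential (`lintegral_comp_normSq`). For fixed `μ` with distinct
entries, the map from `(a, B)` with all `B k > 0` to the eigenvalues `v` is a bijection onto the
vectors strictly interlacing with `μ`, and its inverse has Jacobian `Δ(v) / Δ(μ)` up to sign, where
`Δ` is the Vandermonde product (`setLIntegral_herm2_params`, `setLIntegral_herm3_params`). The
Gaussian weight is `exp (-tr A² / 2)`, and `tr A²` is the sum of the squared eigenvalues; so a block
with eigenvalue density proportional to `Δ(μ)² exp (-∑ μ² / 2)` leads to the joint density
`Δ(μ) Δ(v) exp (-∑ v² / 2)` on interlacing pairs, and integrating out `μ` produces a second factor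
`Δ(v)` (`setLIntegral_interlacing_vandermonde`, `lintegral_borderIntegral`).

In the coordinates given by the largest eigenvalue and the two spacings, the largest eigenvalue is
integrated out by a Gaussian integral. The resulting constant is `1 / (4 π √3)`.
-/

section

open Matrix
open scoped ENNReal

/-! ### Ordered eigenvalues and the characteristic polynomial -/

/-- The characteristic polynomial at a real point, as a product over the ordered eigenvalues.
Together with `eq_of_antitone_of_prod_sub_eq` it characterizes `orderedEigenvalue`. -/
theorem eval_charpoly_eq_prod_orderedEigenvalue {n : ℕ} (A : HermitianMatrix n) (t : ℝ) :
    A.1.charpoly.eval (t : ℂ) = ((∏ k, (t - orderedEigenvalue A k) : ℝ) : ℂ) := by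
  rw [A.2.charpoly_eq, Polynomial.eval_prod, Complex.ofReal_prod]
  simp only [Polynomial.eval_sub, Polynomial.eval_X, Polynomial.eval_C, Complex.coe_algebraMap,
    Complex.ofReal_sub]
  refine Fintype.prod_equiv ((Fintype.equivOfCardEq (Fintype.card_fin _)).symm.trans
    (finCongr (Fintype.card_fin n))) _ _ fun i => ?_
  rfl

/-- Decreasing tuples are determined by the values at the natural numbers of the monic polynomial of
which they are the roots. -/
theorem eq_of_antitone_of_prod_sub_eq {n : ℕ} {u v : Fin n → ℝ} (hu : Antitone u)
    (hv : Antitone v) (h : ∀ t : ℕ, ∏ k, ((t : ℝ) - u k) = ∏ k, ((t : ℝ) - v k)) : u = v := by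
  open Polynomial in
  have hp : ∏ k, (X - C (u k)) = ∏ k, (X - C (v k)) := by
    refine Polynomial.eq_of_infinite_eval_eq _ _
      ((Set.infinite_range_of_injective (Nat.cast_injective (R := ℝ))).mono ?_)
    rintro _ ⟨t, rfl⟩
    simpa [Polynomial.eval_prod] using h t
  have hr := congrArg Polynomial.roots hp
  rw [Polynomial.roots_prod _ _ (Finset.prod_ne_zero_iff.2 fun _ _ => Polynomial.X_sub_C_ne_zero _),
    Polynomial.roots_prod _ _ (Finset.prod_ne_zero_iff.2 fun _ _ => Polynomial.X_sub_C_ne_zero _)]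
    at hr
  simp only [Polynomial.roots_X_sub_C, Multiset.bind_singleton, Fin.univ_val_map,
    Multiset.coe_eq_coe] at hr
  exact List.ofFn_injective (hr.eq_of_sortedGE hu.sortedGE_ofFn hv.sortedGE_ofFn)

/-- The map sending a decreasing tuple `u` to the values `∏ k, (t - u k)`, `t : ℕ`, is continuous
and injective on a closed set, hence a measurable embedding by the Lusin–Souslin theorem; its
composition with the eigenvalues is `A ↦ det (t - A)`, which is visibly measurable. -/
theorem measurable_orderedEigenvalue (n : ℕ) :
    Measurable fun A : HermitianMatrix n => orderedEigenvalue A := by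
  let e : (Fin n → ℝ) → ℕ → ℝ := fun u t => ∏ k, ((t : ℝ) - u k)
  have hcl : IsClosed {u : Fin n → ℝ | Antitone u} := by
    simp only [Antitone, Set.ofPred_forall]
    exact isClosed_iInter fun i => isClosed_iInter fun j => isClosed_iInter fun _ =>
      isClosed_le (continuous_apply j) (continuous_apply i)
  have he : MeasurableEmbedding fun u : {u : Fin n → ℝ | Antitone u} => e u := by
    refine (Continuous.continuousOn (s := {u : Fin n → ℝ | Antitone u})
      (f := e) (by fun_prop)).measurableEmbedding hcl.measurableSet ?_
    intro u hu v hv h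
    exact eq_of_antitone_of_prod_sub_eq hu hv fun t => congrFun h t
  suffices hm : Measurable fun A : HermitianMatrix n =>
      (⟨orderedEigenvalue A, orderedEigenvalue_antitone A⟩ : {u : Fin n → ℝ | Antitone u}) from
    measurable_subtype_coe.comp hm
  rw [← he.measurable_comp_iff]
  refine measurable_pi_lambda _ fun t => ?_
  have : (fun A : HermitianMatrix n => e (orderedEigenvalue A) t) =
      fun A => (A.1.charpoly.eval ((t : ℝ) : ℂ)).re := by
    funext A
    rw [eval_charpoly_eq_prod_orderedEigenvalue, Complex.ofReal_re]
  change Measurable fun A : HermitianMatrix n => e (orderedEigenvalue A) t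
  rw [this]
  simp only [Matrix.eval_charpoly, Matrix.det_apply]
  have hent : ∀ i j : Fin n, Measurable fun A : HermitianMatrix n => A.1 i j := fun i j =>
    (measurable_pi_apply j).comp ((measurable_pi_apply i).comp measurable_subtype_coe)
  refine Complex.measurable_re.comp (Finset.measurable_sum _ fun σ _ => ?_)
  refine Measurable.const_smul (Finset.measurable_prod _ fun i _ => ?_) _
  exact measurable_const.sub (hent _ _)

/-! ### Bordered Hermitian matrices of size two and three -/

/-- The Hermitian matrix with diagonal `x, y` and upper right entry `z`. -/
def herm2 (x y : ℝ) (z : ℂ) : HermitianMatrix 2 :=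
  ⟨!![(x : ℂ), z; star z, (y : ℂ)], by
    ext i j; fin_cases i <;> fin_cases j <;> simp⟩

/-- The Hermitian matrix obtained from `herm2 x y z` by bordering it with a first row `a, b`. -/
def herm3 (a : ℝ) (b : Fin 2 → ℂ) (x y : ℝ) (z : ℂ) : HermitianMatrix 3 :=
  ⟨!![(a : ℂ), b 0, b 1; star (b 0), (x : ℂ), z; star (b 1), star z, (y : ℂ)], by
    ext i j; fin_cases i <;> fin_cases j <;> simp⟩

theorem prod_sub_orderedEigenvalue_herm2 (x y : ℝ) (z : ℂ) (t : ℝ) :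
    ∏ k, (t - orderedEigenvalue (herm2 x y z) k) = (t - x) * (t - y) - Complex.normSq z := by
  apply Complex.ofReal_injective
  rw [← eval_charpoly_eq_prod_orderedEigenvalue, Matrix.eval_charpoly, Matrix.det_fin_two]
  simp [herm2, Complex.mul_conj]

/-- Expansion of the characteristic polynomial of a bordered matrix along the border, with the
adjugate of the `2 × 2` block `t - A` written as `(t - tr A) + A`. -/
theorem prod_sub_orderedEigenvalue_herm3 (a : ℝ) (b : Fin 2 → ℂ) (x y : ℝ) (z : ℂ) (t : ℝ) :
    ∏ k, (t - orderedEigenvalue (herm3 a b x y z) k) =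
      (t - a) * ((t - x) * (t - y) - Complex.normSq z)
        - (∑ k, Complex.normSq (b k)) * (t - x - y)
        - (b ⬝ᵥ ((herm2 x y z).1 *ᵥ star b)).re := by
  have h := eval_charpoly_eq_prod_orderedEigenvalue (herm3 a b x y z) t
  rw [Matrix.eval_charpoly, Matrix.det_fin_three] at h
  rw [← Complex.ofReal_re (∏ k, _), ← h]
  simp [herm2, herm3, Complex.normSq_apply, dotProduct, mulVec, Fin.sum_univ_two]
  ring

/-- Diagonalization in the form needed for bordered matrices: in suitable unitary coordinates `W`
the form `b ↦ b A b*` is diagonal, with coefficients the ordered eigenvalues. -/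
theorem exists_unitary_coordinates {n : ℕ} (A : HermitianMatrix n) :
    ∃ W : Matrix (Fin n) (Fin n) ℂ, ‖W.det‖ = 1 ∧ ∀ b : Fin n → ℂ,
      ∑ k, Complex.normSq ((W *ᵥ b) k) = ∑ k, Complex.normSq (b k) ∧
      ∑ k, orderedEigenvalue A k * Complex.normSq ((W *ᵥ b) k) =
        (b ⬝ᵥ (A.1 *ᵥ star b)).re := by
  let U : Matrix (Fin n) (Fin n) ℂ := (A.2.eigenvectorUnitary : Matrix (Fin n) (Fin n) ℂ)
  have hU1 : U * Uᴴ = 1 := Unitary.coe_mul_star_self A.2.eigenvectorUnitary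
  let e : Fin n ≃ Fin n := (Fintype.equivOfCardEq (Fintype.card_fin _)).symm.trans
    (finCongr (Fintype.card_fin n))
  have hA : A.1 = U * diagonal (fun i => (orderedEigenvalue A (e i) : ℂ)) * Uᴴ := by
    conv_lhs => rw [A.2.spectral_theorem, Unitary.conjStarAlgAut_apply]
    rfl
  have key : ∀ d : Fin n → ℝ, ∀ b : Fin n → ℂ,
      ∑ k, d k * Complex.normSq ((Uᵀ.submatrix e.symm id *ᵥ b) k) =
        (b ⬝ᵥ ((U * diagonal (fun i => (d (e i) : ℂ)) * Uᴴ) *ᵥ star b)).re := by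
    intro d b
    rw [← e.sum_comp]
    have h1 : b ⬝ᵥ ((U * diagonal (fun i => (d (e i) : ℂ)) * Uᴴ) *ᵥ star b) =
        (Uᵀ *ᵥ b) ⬝ᵥ (diagonal (fun i => (d (e i) : ℂ)) *ᵥ star (Uᵀ *ᵥ b)) := by
      rw [star_mulVec, ← mulVec_mulVec, ← mulVec_mulVec, dotProduct_mulVec, mulVec_transpose]
      congr 2
      rw [← mulVec_transpose]
      rfl
    rw [h1]
    simp only [dotProduct, mulVec_diagonal, Complex.re_sum]
    refine Finset.sum_congr rfl fun k _ => ?_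
    have h2 : (Uᵀ.submatrix e.symm id *ᵥ b) (e k) = (Uᵀ *ᵥ b) k := by
      simp [mulVec, dotProduct]
    rw [h2]
    simp only [Complex.normSq_apply, Pi.star_apply, Complex.mul_re, Complex.mul_im,
      Complex.ofReal_re, Complex.ofReal_im, Complex.star_def, Complex.conj_re, Complex.conj_im]
    ring
  refine ⟨Uᵀ.submatrix e.symm id, ?_, fun b => ⟨?_, ?_⟩⟩
  · have h4 := congrArg (fun M : Matrix (Fin n) (Fin n) ℂ => ‖M.det‖) hU1
    simp only [det_mul, det_conjTranspose, norm_mul, norm_star, det_one, norm_one] at h4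
    have h5 : ‖U.det‖ = 1 := by nlinarith [norm_nonneg U.det]
    rw [← det_transpose] at h5
    rw [show Uᵀ.submatrix e.symm id = (Uᵀ.submatrix id e).submatrix e.symm e.symm by ext; simp,
      det_submatrix_equiv_self, det_permute']
    rw [norm_mul]
    -- Reindexing the rows multiplies the determinant by a sign.
    rcases Int.units_eq_one_or (Equiv.Perm.sign e) with h | h <;> simp_all
  · have := key 1 b
    simpa [hU1, dotProduct, Complex.normSq_apply] using this
  · rw [key, ← hA]

theorem sum_and_prod_orderedEigenvalue_herm2 (x y : ℝ) (z : ℂ) :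
    orderedEigenvalue (herm2 x y z) 0 + orderedEigenvalue (herm2 x y z) 1 = x + y ∧
    orderedEigenvalue (herm2 x y z) 0 * orderedEigenvalue (herm2 x y z) 1 =
      x * y - Complex.normSq z := by
  have h0 := prod_sub_orderedEigenvalue_herm2 x y z 0
  have h1 := prod_sub_orderedEigenvalue_herm2 x y z 1
  rw [Fin.prod_univ_two] at h0 h1
  constructor <;> linarith

theorem prod_sub_orderedEigenvalue_herm3_diagonal (a : ℝ) (b : Fin 2 → ℂ) (x y t : ℝ) :
    ∏ k, (t - orderedEigenvalue (herm3 a b x y 0) k) =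
      (t - a) * (t - x) * (t - y) - Complex.normSq (b 0) * (t - y)
        - Complex.normSq (b 1) * (t - x) := by
  rw [prod_sub_orderedEigenvalue_herm3]
  simp [herm2, Complex.normSq_apply, dotProduct, mulVec, Fin.sum_univ_two]
  ring

/-- A unitary change of the border diagonalizes the block without changing the eigenvalues. -/
theorem orderedEigenvalue_herm3_eq_diagonal (x y : ℝ) (z : ℂ) :
    ∃ W : Matrix (Fin 2) (Fin 2) ℂ, ‖W.det‖ = 1 ∧
      (∀ b, ∑ k, Complex.normSq ((W *ᵥ b) k) = ∑ k, Complex.normSq (b k)) ∧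
      ∀ a b, orderedEigenvalue (herm3 a b x y z) =
        orderedEigenvalue (herm3 a (W *ᵥ b) (orderedEigenvalue (herm2 x y z) 0)
          (orderedEigenvalue (herm2 x y z) 1) 0) := by
  obtain ⟨W, hW, h⟩ := exists_unitary_coordinates (herm2 x y z)
  refine ⟨W, hW, fun b => (h b).1, fun a b => ?_⟩
  refine eq_of_antitone_of_prod_sub_eq (orderedEigenvalue_antitone _)
    (orderedEigenvalue_antitone _) fun t => ?_
  obtain ⟨hs, hp⟩ := sum_and_prod_orderedEigenvalue_herm2 x y z
  rw [prod_sub_orderedEigenvalue_herm3, prod_sub_orderedEigenvalue_herm3_diagonal, ← (h b).1,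
    ← (h b).2, Fin.sum_univ_two, Fin.sum_univ_two]
  linear_combination ((t : ℝ) * (t - a) - Complex.normSq ((W *ᵥ b) 0)
    - Complex.normSq ((W *ᵥ b) 1)) * hs - (t - a) * hp

/-! ### Measurability and integration over complex entries -/

@[fun_prop]
theorem Measurable.orderedEigenvalue_herm2 {Ω : Type*} [MeasurableSpace Ω] {x y : Ω → ℝ}
    {z : Ω → ℂ} (hx : Measurable x) (hy : Measurable y) (hz : Measurable z) :
    Measurable fun ω => orderedEigenvalue (herm2 (x ω) (y ω) (z ω)) := by
  refine (measurable_orderedEigenvalue 2).comp (Measurable.subtype_mk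
    (measurable_pi_lambda _ fun i => measurable_pi_lambda _ fun j => ?_))
  fin_cases i <;> fin_cases j <;> simp <;> fun_prop

@[fun_prop]
theorem Measurable.orderedEigenvalue_herm3 {Ω : Type*} [MeasurableSpace Ω] {a x y : Ω → ℝ}
    {b : Ω → Fin 2 → ℂ} {z : Ω → ℂ} (ha : Measurable a) (hb : Measurable b) (hx : Measurable x)
    (hy : Measurable y) (hz : Measurable z) :
    Measurable fun ω => orderedEigenvalue (herm3 (a ω) (b ω) (x ω) (y ω) (z ω)) := by
  refine (measurable_orderedEigenvalue 3).comp (Measurable.subtype_mk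
    (measurable_pi_lambda _ fun i => measurable_pi_lambda _ fun j => ?_))
  fin_cases i <;> fin_cases j <;> simp <;> fun_prop

/-- The real determinant of a complex linear map is the squared modulus of its complex determinant.
-/
theorem measurePreserving_mulVec {n : ℕ} {W : Matrix (Fin n) (Fin n) ℂ} (hW : ‖W.det‖ = 1) :
    MeasurePreserving (fun b : Fin n → ℂ => W *ᵥ b) := by
  have hdet : LinearMap.det ((Matrix.toLin' W).restrictScalars ℝ) = 1 := by
    rw [LinearMap.det_restrictScalars, LinearMap.det_toLin', Algebra.norm_complex_apply,
      Complex.normSq_eq_norm_sq, hW, one_pow]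
  refine ⟨by fun_prop, ?_⟩
  have := Measure.map_linearMap_addHaar_eq_smul_addHaar (volume : Measure (Fin n → ℂ))
    (f := (Matrix.toLin' W).restrictScalars ℝ) (by rw [hdet]; exact one_ne_zero)
  rw [hdet] at this
  simp only [inv_one, abs_one, ENNReal.ofReal_one, one_smul] at this
  exact this

/-- Polar coordinates and the substitution `s = r ^ 2`. -/
theorem lintegral_comp_normSq {f : ℝ → ℝ≥0∞} (hf : Measurable f) :
    ∫⁻ z : ℂ, f (Complex.normSq z) = ENNReal.ofReal Real.pi * ∫⁻ s in Set.Ioi 0, f s := by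
  have himage : (fun r : ℝ => r ^ 2) '' Set.Ioi 0 = Set.Ioi 0 := by
    ext s
    constructor
    · rintro ⟨r, hr, rfl⟩
      exact pow_pos (Set.mem_Ioi.1 hr) 2
    · intro hs
      exact ⟨√s, Real.sqrt_pos.2 hs, Real.sq_sqrt (Set.mem_Ioi.1 hs).le⟩
  have hsq : ∫⁻ s in Set.Ioi 0, f s =
      ∫⁻ r in Set.Ioi (0 : ℝ), ENNReal.ofReal 2 * (ENNReal.ofReal r * f (r ^ 2)) := by
    conv_lhs => rw [← himage]
    rw [lintegral_image_eq_lintegral_abs_deriv_mul measurableSet_Ioi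
      (f' := fun r => 2 * r) (fun r _ => by simpa using (hasDerivAt_pow 2 r).hasDerivWithinAt) ?_]
    · refine setLIntegral_congr_fun measurableSet_Ioi fun r hr => ?_
      have hr : (0 : ℝ) < r := hr
      rw [abs_of_pos (by positivity), ENNReal.ofReal_mul (by norm_num), mul_assoc]
    · intro r hr s hs h
      exact (pow_left_inj₀ (le_of_lt hr) (le_of_lt hs) two_ne_zero).1 h
  rw [hsq, lintegral_const_mul _ (by fun_prop), ← Complex.lintegral_comp_polarCoord_symm,
    polarCoord_target, Measure.volume_eq_prod, ← Measure.prod_restrict]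
  have hpol : ∀ p : ℝ × ℝ, Complex.normSq (Complex.polarCoord.symm p) = p.1 ^ 2 := fun p => by
    rw [Complex.normSq_eq_norm_sq, Complex.norm_polarCoord_symm, sq_abs]
  simp only [hpol, smul_eq_mul]
  rw [lintegral_prod _ (by fun_prop)]
  simp only [lintegral_const, Measure.restrict_apply_univ, Real.volume_Ioo]
  rw [lintegral_mul_const _ (by fun_prop), mul_comm, ← mul_assoc,
    ← ENNReal.ofReal_mul Real.pi_pos.le]
  congr 2
  ring

theorem lintegral_fin_two {E : Type*} [MeasureSpace E] [SigmaFinite (volume : Measure E)]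
    {f : (Fin 2 → E) → ℝ≥0∞} (hf : Measurable f) : ∫⁻ v, f v = ∫⁻ a, ∫⁻ b, f ![a, b] := by
  rw [← (MeasurePreserving.symm _ (volume_preserving_finTwoArrow E)).lintegral_comp hf,
    Measure.volume_eq_prod, lintegral_prod _ (by fun_prop)]
  rfl

theorem lintegral_fin_three {f : (Fin 3 → ℝ) → ℝ≥0∞} (hf : Measurable f) :
    ∫⁻ v, f v = ∫⁻ a, ∫⁻ b, ∫⁻ c, f ![a, b, c] := by
  have h : MeasurePreserving (fun p : ℝ × ℝ × ℝ => ![p.1, p.2.1, p.2.2]) := by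
    refine ⟨by fun_prop, (Measure.pi_eq fun s _ => ?_).symm⟩
    have : (fun p : ℝ × ℝ × ℝ => ![p.1, p.2.1, p.2.2]) ⁻¹' Set.univ.pi s =
        s 0 ×ˢ s 1 ×ˢ s 2 := by
      ext p
      simp [Fin.forall_fin_succ]
    rw [Measure.map_apply (by fun_prop) (.univ_pi ‹_›), this]
    simp [Measure.volume_eq_prod, Measure.prod_prod, Fin.prod_univ_three, mul_assoc]
  rw [← h.lintegral_comp hf, Measure.volume_eq_prod, lintegral_prod _ (by fun_prop)]
  refine lintegral_congr fun a => ?_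
  rw [Measure.volume_eq_prod, lintegral_prod _ (by fun_prop)]

theorem lintegral_comp_normSq_fin_two {f : ℝ → ℝ → ℝ≥0∞}
    (hf : Measurable (Function.uncurry f)) :
    ∫⁻ b : Fin 2 → ℂ, f (Complex.normSq (b 0)) (Complex.normSq (b 1)) =
      ENNReal.ofReal Real.pi ^ 2 * ∫⁻ s in Set.Ioi 0, ∫⁻ t in Set.Ioi 0, f s t := by
  have hn : Measurable Complex.normSq := Complex.continuous_normSq.measurable
  have hm : Measurable fun b : Fin 2 → ℂ => f (Complex.normSq (b 0)) (Complex.normSq (b 1)) :=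
    hf.comp ((hn.comp (measurable_pi_apply 0)).prodMk (hn.comp (measurable_pi_apply 1)))
  rw [lintegral_fin_two hm]
  simp only [Matrix.cons_val_zero, Matrix.cons_val_one]
  have h1 : ∀ s, Measurable (f s) := fun s => hf.comp measurable_prodMk_left
  simp only [lintegral_comp_normSq (h1 _)]
  have h2 : Measurable fun s => ∫⁻ t in Set.Ioi 0, f s t := hf.lintegral_prod_right
  rw [lintegral_const_mul _ (f := fun z => ∫⁻ t in Set.Ioi 0, f (Complex.normSq z) t) (h2.comp hn),
    lintegral_comp_normSq h2, sq, mul_assoc]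

/-! ### Changing variables from matrix entries to eigenvalues -/

/-- Change of variables along a map given by `f` with inverse `g`. -/
theorem lintegral_eq_lintegral_abs_det_of_invOn {n : ℕ} {S T : Set (Fin n → ℝ)}
    (hS : MeasurableSet S) {f g : (Fin n → ℝ) → Fin n → ℝ}
    {J : (Fin n → ℝ) → Matrix (Fin n) (Fin n) ℝ}
    (hf : ∀ v ∈ S, ∀ i, HasFDerivAt (fun w => f w i)
      ((ContinuousLinearMap.proj (R := ℝ) (φ := fun _ => ℝ) i).comp
        (LinearMap.toContinuousLinearMap (Matrix.toLin' (J v)))) v)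
    (hinv : Set.InvOn g f S T) (hfST : Set.MapsTo f S T) (hgTS : Set.MapsTo g T S)
    (F : (Fin n → ℝ) → ℝ≥0∞) :
    ∫⁻ w in T, F w = ∫⁻ v in S, ENNReal.ofReal |(J v).det| * F (f v) := by
  have hb := hinv.bijOn hfST hgTS
  rw [← hb.image_eq, lintegral_image_eq_lintegral_abs_det_fderiv_mul volume hS
    (f' := fun v => LinearMap.toContinuousLinearMap (Matrix.toLin' (J v)))
    (fun v hv => (hasFDerivAt_pi'.2 (hf v hv)).hasFDerivWithinAt) hb.injOn]
  refine lintegral_congr fun v => ?_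
  rw [ContinuousLinearMap.det, LinearMap.coe_toContinuousLinearMap, LinearMap.det_toLin']

/-- The characteristic polynomial of `herm2 w y √s` in terms of its eigenvalues. -/
theorem orderedEigenvalue_herm2_sqrt {w y : ℝ} {s : ℝ} (hs : 0 ≤ s) (t : ℝ) :
    (t - orderedEigenvalue (herm2 w y √s) 0) * (t - orderedEigenvalue (herm2 w y √s) 1) =
      (t - w) * (t - y) - s := by
  rw [← Fin.prod_univ_two (fun k => t - orderedEigenvalue (herm2 w y √s) k),
    prod_sub_orderedEigenvalue_herm2, Complex.normSq_ofReal, Real.mul_self_sqrt hs]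

/-- The matrix `herm2 x y √s` with prescribed entry `y` and prescribed eigenvalues `v` strictly
separated by `y`. -/
theorem orderedEigenvalue_herm2_of_interlacing {y : ℝ} {v : Fin 2 → ℝ}
    (hv : v 1 < y ∧ y < v 0) :
    orderedEigenvalue (herm2 (v 0 + v 1 - y) y √((v 0 - y) * (y - v 1))) = v := by
  refine eq_of_antitone_of_prod_sub_eq (orderedEigenvalue_antitone _) ?_ fun t => ?_
  · intro i j hij
    have := hv.1.trans hv.2
    fin_cases i <;> fin_cases j <;> simp_all [this.le]
  · rw [Fin.prod_univ_two, Fin.prod_univ_two,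
      orderedEigenvalue_herm2_sqrt (mul_pos (sub_pos.2 hv.2) (sub_pos.2 hv.1)).le]
    ring

/-- The characteristic polynomial of a bordered diagonal matrix in terms of its eigenvalues. -/
theorem orderedEigenvalue_herm3_sqrt {a x y p q : ℝ} (hp : 0 ≤ p) (hq : 0 ≤ q) (t : ℝ) :
    (t - orderedEigenvalue (herm3 a ![(√p : ℂ), (√q : ℂ)] x y 0) 0) *
      (t - orderedEigenvalue (herm3 a ![(√p : ℂ), (√q : ℂ)] x y 0) 1) *
      (t - orderedEigenvalue (herm3 a ![(√p : ℂ), (√q : ℂ)] x y 0) 2) =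
        (t - a) * (t - x) * (t - y) - p * (t - y) - q * (t - x) := by
  rw [← Fin.prod_univ_three
      (fun k => t - orderedEigenvalue (herm3 a ![(√p : ℂ), (√q : ℂ)] x y 0) k),
    prod_sub_orderedEigenvalue_herm3_diagonal]
  simp only [cons_val_zero, cons_val_one, Complex.normSq_ofReal,
    Real.mul_self_sqrt hp, Real.mul_self_sqrt hq]

/-- The bordered diagonal matrix with diagonal block `x, y` and prescribed eigenvalues `v`
interlacing with `x, y`: the squared border entries are, up to sign, the residues of the quotient of
the characteristic polynomials. -/
theorem orderedEigenvalue_herm3_of_interlacing {x y : ℝ} {v : Fin 3 → ℝ}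
    (hv : v 2 < y ∧ y < v 1 ∧ v 1 < x ∧ x < v 0) :
    orderedEigenvalue (herm3 (v 0 + v 1 + v 2 - x - y)
      ![(√((v 0 - x) * (x - v 1) * (x - v 2) / (x - y)) : ℂ),
        (√((v 0 - y) * (v 1 - y) * (y - v 2) / (x - y)) : ℂ)] x y 0) = v := by
  obtain ⟨h2, h1, h1', h0⟩ := hv
  have e0 := sub_pos.2 h0
  have e1 := sub_pos.2 h1
  have e1' := sub_pos.2 h1'
  have e2 := sub_pos.2 h2
  have e3 : 0 < x - v 2 := by linarith
  have e4 : 0 < v 0 - y := by linarith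
  have e5 : 0 < x - y := by linarith
  refine eq_of_antitone_of_prod_sub_eq (orderedEigenvalue_antitone _) ?_ fun t => ?_
  · refine Fin.antitone_iff_succ_le.2 fun i => ?_
    fin_cases i <;> simp <;> linarith
  · rw [Fin.prod_univ_three, Fin.prod_univ_three]
    refine (orderedEigenvalue_herm3_sqrt (by positivity) (by positivity) t).trans ?_
    field_simp
    ring

/-- For a fixed diagonal entry `y`, the other diagonal entry and the squared modulus of the
off-diagonal entry are coordinates equivalent to the eigenvalues `v`, which range over all pairs
separated by `y`; the Jacobian is `v 0 - v 1`. -/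
theorem setLIntegral_herm2_params (y : ℝ) (F : (Fin 2 → ℝ) → ℝ≥0∞) :
    ∫⁻ w in {w : Fin 2 → ℝ | 0 < w 1}, F w =
      ∫⁻ v in {v : Fin 2 → ℝ | v 1 < y ∧ y < v 0},
        ENNReal.ofReal (v 0 - v 1) * F ![v 0 + v 1 - y, (v 0 - y) * (y - v 1)] := by
  have hS : MeasurableSet {v : Fin 2 → ℝ | v 1 < y ∧ y < v 0} := by
    simp only [Set.ofPred_and]
    exact (measurableSet_lt (by fun_prop) (by fun_prop)).inter
      (measurableSet_lt (by fun_prop) (by fun_prop))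
  have hspec : ∀ w ∈ {w : Fin 2 → ℝ | 0 < w 1}, ∀ t : ℝ,
      (t - orderedEigenvalue (herm2 (w 0) y √(w 1)) 0) *
        (t - orderedEigenvalue (herm2 (w 0) y √(w 1)) 1) = (t - w 0) * (t - y) - w 1 :=
    fun w hw t => orderedEigenvalue_herm2_sqrt (le_of_lt hw) t
  rw [lintegral_eq_lintegral_abs_det_of_invOn hS
    (f := fun v => ![v 0 + v 1 - y, (v 0 - y) * (y - v 1)])
    (g := fun w => orderedEigenvalue (herm2 (w 0) y √(w 1)))
    (J := fun v => !![1, 1; y - v 1, -(v 0 - y)]) ?_ ⟨?_, ?_⟩ ?_ ?_]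
  · refine setLIntegral_congr_fun hS fun v hv => ?_
    have : (!![1, 1; y - v 1, -(v 0 - y)] : Matrix (Fin 2) (Fin 2) ℝ).det = -(v 0 - v 1) := by
      rw [det_fin_two_of]; ring
    rw [this, abs_neg, abs_of_pos (by linarith [hv.1, hv.2])]
  · intro v hv i
    have h0 := hasFDerivAt_apply (𝕜 := ℝ) (F' := fun _ : Fin 2 => ℝ) 0 v
    have h1 := hasFDerivAt_apply (𝕜 := ℝ) (F' := fun _ : Fin 2 => ℝ) 1 v
    fin_cases i
    · refine ((h0.add h1).sub_const y).congr_fderiv ?_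
      refine ContinuousLinearMap.ext fun u => ?_
      simp [dotProduct]
    · refine ((h0.sub_const y).mul (h1.const_sub y)).congr_fderiv ?_
      refine ContinuousLinearMap.ext fun u => ?_
      simp [dotProduct]
      ring
  · intro v hv
    exact orderedEigenvalue_herm2_of_interlacing hv
  · intro w hw
    -- Comparing the values at `0, 1` recovers the trace; the value at `y` is `-w 1`.
    have h0 := hspec w hw 0
    have h1 := hspec w hw 1
    have hy := hspec w hw y
    ext i; fin_cases i
    · simp
      linarith
    · simp
      linarith
  · intro v hv
    exact mul_pos (sub_pos.2 hv.2) (sub_pos.2 hv.1)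
  · intro w hw
    have hy := hspec w hw y
    have ha : orderedEigenvalue (herm2 (w 0) y √(w 1)) 1 ≤
      orderedEigenvalue (herm2 (w 0) y √(w 1)) 0 := orderedEigenvalue_antitone _ (Fin.zero_le 1)
    have hw : 0 < w 1 := hw
    constructor
    · by_contra! h
      nlinarith
    · by_contra! h
      nlinarith

/-- For a fixed diagonal block with entries `y < x`, the corner entry and the squared moduli of the
border are coordinates equivalent to the eigenvalues `v`, which range over all triples interlacing
with `x, y`; the Jacobian is a quotient of Vandermonde products. -/
theorem setLIntegral_herm3_params {x y : ℝ} (hxy : y < x) (F : (Fin 3 → ℝ) → ℝ≥0∞) :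
    ∫⁻ w in {w : Fin 3 → ℝ | 0 < w 1 ∧ 0 < w 2}, F w =
      ∫⁻ v in {v : Fin 3 → ℝ | v 2 < y ∧ y < v 1 ∧ v 1 < x ∧ x < v 0},
        ENNReal.ofReal ((v 0 - v 1) * (v 1 - v 2) * (v 0 - v 2) / (x - y)) *
          F ![v 0 + v 1 + v 2 - x - y, (v 0 - x) * (x - v 1) * (x - v 2) / (x - y),
            (v 0 - y) * (v 1 - y) * (y - v 2) / (x - y)] := by
  have hd : 0 < x - y := sub_pos.2 hxy
  have hS : MeasurableSet {v : Fin 3 → ℝ | v 2 < y ∧ y < v 1 ∧ v 1 < x ∧ x < v 0} := by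
    simp only [Set.ofPred_and]
    refine .inter ?_ (.inter ?_ (.inter ?_ ?_)) <;>
      exact measurableSet_lt (by fun_prop) (by fun_prop)
  let L : (Fin 3 → ℝ) → Fin 3 → ℝ := fun w =>
    orderedEigenvalue (herm3 (w 0) ![(√(w 1) : ℂ), (√(w 2) : ℂ)] x y 0)
  have hspec : ∀ w ∈ {w : Fin 3 → ℝ | 0 < w 1 ∧ 0 < w 2}, ∀ t : ℝ,
      (t - L w 0) * (t - L w 1) * (t - L w 2) =
        (t - w 0) * (t - x) * (t - y) - w 1 * (t - y) - w 2 * (t - x) :=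
    fun w hw t => orderedEigenvalue_herm3_sqrt hw.1.le hw.2.le t
  have hmaps : Set.MapsTo (fun v : Fin 3 → ℝ =>
      ![v 0 + v 1 + v 2 - x - y, (v 0 - x) * (x - v 1) * (x - v 2) / (x - y),
        (v 0 - y) * (v 1 - y) * (y - v 2) / (x - y)])
      {v : Fin 3 → ℝ | v 2 < y ∧ y < v 1 ∧ v 1 < x ∧ x < v 0}
      {w : Fin 3 → ℝ | 0 < w 1 ∧ 0 < w 2} := by
    rintro v ⟨h2, h1, h1', h0⟩
    have e0 := sub_pos.2 h0
    have e1 := sub_pos.2 h1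
    have e1' := sub_pos.2 h1'
    have e2 := sub_pos.2 h2
    have e3 : 0 < x - v 2 := by linarith
    have e4 : 0 < v 0 - y := by linarith
    exact ⟨by simp; positivity, by simp; positivity⟩
  rw [lintegral_eq_lintegral_abs_det_of_invOn hS
    (f := fun v => ![v 0 + v 1 + v 2 - x - y, (v 0 - x) * (x - v 1) * (x - v 2) / (x - y),
            (v 0 - y) * (v 1 - y) * (y - v 2) / (x - y)])
    (g := L)
    (J := fun v => !![1, 1, 1;
      (x - v 1) * (x - v 2) / (x - y), -((v 0 - x) * (x - v 2)) / (x - y),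
        -((v 0 - x) * (x - v 1)) / (x - y);
      (v 1 - y) * (y - v 2) / (x - y), (v 0 - y) * (y - v 2) / (x - y),
        -((v 0 - y) * (v 1 - y)) / (x - y)]) ?_ ⟨?_, ?_⟩ hmaps ?_]
  · refine setLIntegral_congr_fun hS fun v hv => ?_
    obtain ⟨h2, h1, h1', h0⟩ := hv
    have e0 : 0 < v 0 - v 1 := by linarith
    have e1 : 0 < v 1 - v 2 := by linarith
    have e2 : 0 < v 0 - v 2 := by linarith
    congr 2
    rw [det_fin_three, ← abs_of_pos (show 0 < (v 0 - v 1) * (v 1 - v 2) * (v 0 - v 2) / (x - y) by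
      positivity)]
    congr 1
    simp
    field_simp
    ring
  · intro v hv i
    have h0 := hasFDerivAt_apply (𝕜 := ℝ) (F' := fun _ : Fin 3 => ℝ) 0 v
    have h1 := hasFDerivAt_apply (𝕜 := ℝ) (F' := fun _ : Fin 3 => ℝ) 1 v
    have h2 := hasFDerivAt_apply (𝕜 := ℝ) (F' := fun _ : Fin 3 => ℝ) 2 v
    fin_cases i
    · refine ((((h0.add h1).add h2).sub_const x).sub_const y).congr_fderiv ?_
      refine ContinuousLinearMap.ext fun u => ?_
      simp [dotProduct, Fin.sum_univ_three]
    · refine ((((h0.sub_const x).mul (h1.const_sub x)).mul (h2.const_sub x)).mul_const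
        (x - y)⁻¹).congr_fderiv ?_
      refine ContinuousLinearMap.ext fun u => ?_
      simp [dotProduct, Fin.sum_univ_three]
      ring
    · refine ((((h0.sub_const y).mul (h1.sub_const y)).mul (h2.const_sub y)).mul_const
        (x - y)⁻¹).congr_fderiv ?_
      refine ContinuousLinearMap.ext fun u => ?_
      simp [dotProduct, Fin.sum_univ_three]
      ring
  · intro v hv
    exact orderedEigenvalue_herm3_of_interlacing hv
  · intro w hw
    -- The second difference at `-1, 0, 1` recovers the trace; the values at `x` and `y` recover
    -- the squared border entries.
    have h0 := hspec w hw 0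
    have h1 := hspec w hw 1
    have h1' := hspec w hw (-1)
    have hx := hspec w hw x
    have hy := hspec w hw y
    ext i; fin_cases i
    · simp
      linarith
    · simp
      field_simp
      linarith
    · simp
      field_simp
      linarith
  · intro w hw
    have hx := hspec w hw x
    have hy := hspec w hw y
    have ha : L w 1 ≤ L w 0 := orderedEigenvalue_antitone _ (Fin.zero_le 1)
    have hb : L w 2 ≤ L w 1 := orderedEigenvalue_antitone _ (by decide : (1 : Fin 3) ≤ 2)
    -- The characteristic polynomial is negative at `x` and positive at `y`, which forces the
    -- eigenvalues to interlace with `x, y`.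
    have hx' : (x - L w 0) * (x - L w 1) * (x - L w 2) < 0 := by
      nlinarith [mul_pos hw.1 hd]
    have hy' : 0 < (y - L w 0) * (y - L w 1) * (y - L w 2) := by
      nlinarith [mul_pos hw.2 hd]
    have h2 : L w 2 < y := by
      by_contra! h
      have := mul_nonneg (mul_nonneg (sub_nonneg.2 (h.trans (hb.trans ha)))
        (sub_nonneg.2 (h.trans hb))) (sub_nonneg.2 h)
      linarith
    have h0 : x < L w 0 := by
      by_contra! h
      have := mul_nonneg (mul_nonneg (sub_nonneg.2 h)
        (sub_nonneg.2 (ha.trans h))) (sub_nonneg.2 (hb.trans (ha.trans h)))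
      linarith
    refine ⟨h2, ?_, ?_, h0⟩
    · by_contra! h
      have := mul_nonneg (mul_nonneg (sub_nonneg.2 (hxy.trans h0).le)
        (sub_nonneg.2 h)) (sub_nonneg.2 h2.le)
      linarith
    · by_contra! h
      have := mul_nonneg (mul_nonneg (sub_nonneg.2 h0.le)
        (sub_nonneg.2 h)) (sub_nonneg.2 (h2.trans hxy).le)
      linarith

/-! ### Integrating over one border -/

theorem orderedEigenvalue_herm2_eq_sqrt_normSq (x y : ℝ) (z : ℂ) :
    orderedEigenvalue (herm2 x y z) = orderedEigenvalue (herm2 x y √(Complex.normSq z)) := by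
  refine eq_of_antitone_of_prod_sub_eq (orderedEigenvalue_antitone _)
    (orderedEigenvalue_antitone _) fun t => ?_
  rw [prod_sub_orderedEigenvalue_herm2, prod_sub_orderedEigenvalue_herm2, Complex.normSq_ofReal,
    Real.mul_self_sqrt (Complex.normSq_nonneg _)]

theorem orderedEigenvalue_herm3_diagonal_eq_sqrt_normSq (a : ℝ) (b : Fin 2 → ℂ) (x y : ℝ) :
    orderedEigenvalue (herm3 a b x y 0) = orderedEigenvalue
      (herm3 a ![(√(Complex.normSq (b 0)) : ℂ), (√(Complex.normSq (b 1)) : ℂ)] x y 0) := by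
  refine eq_of_antitone_of_prod_sub_eq (orderedEigenvalue_antitone _)
    (orderedEigenvalue_antitone _) fun t => ?_
  simp only [prod_sub_orderedEigenvalue_herm3_diagonal, cons_val_zero, cons_val_one,
    Complex.normSq_ofReal, Real.mul_self_sqrt (Complex.normSq_nonneg _)]

/-- Tonelli's theorem over a measurable relation. -/
theorem lintegral_setLIntegral_swap {α β : Type*} [MeasureSpace α] [MeasureSpace β]
    [SFinite (volume : Measure α)] [SFinite (volume : Measure β)] {p : α → β → Prop}
    (hp : MeasurableSet {x : α × β | p x.1 x.2}) {f : α → β → ℝ≥0∞}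
    (hf : Measurable (Function.uncurry f)) :
    ∫⁻ a, ∫⁻ b in {b | p a b}, f a b = ∫⁻ b, ∫⁻ a in {a | p a b}, f a b := by
  have h1 : ∀ a, MeasurableSet {b | p a b} := fun a => measurable_prodMk_left hp
  have h2 : ∀ b, MeasurableSet {a | p a b} := fun b => measurable_prodMk_right hp
  simp only [← lintegral_indicator (h1 _), ← lintegral_indicator (h2 _)]
  rw [lintegral_lintegral_swap]
  · rfl
  · exact (hf.indicator hp).aemeasurable

/-- The joint density of the eigenvalues of the `2 × 2` block. One factor `v 0 - v 1` is the
Jacobian of `setLIntegral_herm2_params`, the other the length of the interval of admissible `y`.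
Since `ENNReal.ofReal` vanishes on negative numbers, only `v 1 < v 0` contributes. -/
theorem lintegral_herm2 {G : (Fin 2 → ℝ) → ℝ≥0∞} (hG : Measurable G) :
    ∫⁻ y : ℝ, ∫⁻ x : ℝ, ∫⁻ z : ℂ, G (orderedEigenvalue (herm2 x y z)) *
        ENNReal.ofReal (Real.exp (-(x ^ 2 + y ^ 2) / 2 - Complex.normSq z)) =
      ENNReal.ofReal Real.pi * ∫⁻ v : Fin 2 → ℝ, ENNReal.ofReal (v 0 - v 1) ^ 2 *
        (G v * ENNReal.ofReal (Real.exp (-(v 0 ^ 2 + v 1 ^ 2) / 2))) := by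
  have step : ∀ y : ℝ, ∫⁻ x : ℝ, ∫⁻ z : ℂ, G (orderedEigenvalue (herm2 x y z)) *
        ENNReal.ofReal (Real.exp (-(x ^ 2 + y ^ 2) / 2 - Complex.normSq z)) =
      ENNReal.ofReal Real.pi * ∫⁻ v in {v : Fin 2 → ℝ | v 1 < y ∧ y < v 0},
        ENNReal.ofReal (v 0 - v 1) *
        (G v * ENNReal.ofReal (Real.exp (-(v 0 ^ 2 + v 1 ^ 2) / 2))) := by
    intro y
    have hT : MeasurableSet {w : Fin 2 → ℝ | 0 < w 1} :=
      measurableSet_lt (by fun_prop) (by fun_prop)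
    let h : ℝ → ℝ → ℝ≥0∞ := fun x s => G (orderedEigenvalue (herm2 x y √s)) *
      ENNReal.ofReal (Real.exp (-(x ^ 2 + y ^ 2) / 2 - s))
    have hh : Measurable (Function.uncurry h) := by
      simp only [h, Function.uncurry_def]
      fun_prop
    have hhx : ∀ x, Measurable (h x) := fun x => by
      simp only [h]
      fun_prop
    have hdef : ∀ x s, h x s = G (orderedEigenvalue (herm2 x y √s)) *
      ENNReal.ofReal (Real.exp (-(x ^ 2 + y ^ 2) / 2 - s)) := fun _ _ => rfl
    clear_value h
    have hw : Measurable fun w : Fin 2 → ℝ => h (w 0) (w 1) :=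
      hh.comp (by fun_prop : Measurable fun w : Fin 2 → ℝ => (w 0, w 1))
    calc _ = ∫⁻ x, ∫⁻ z, h x (Complex.normSq z) := by
            simp only [hdef, ← orderedEigenvalue_herm2_eq_sqrt_normSq]
      _ = ∫⁻ x, ENNReal.ofReal Real.pi * ∫⁻ s in Set.Ioi 0, h x s :=
            lintegral_congr fun x =>
              lintegral_comp_normSq (hhx x)
      _ = ENNReal.ofReal Real.pi * ∫⁻ x, ∫⁻ s in Set.Ioi 0, h x s :=
            lintegral_const_mul' _ _ ENNReal.ofReal_ne_top
      _ = ENNReal.ofReal Real.pi * ∫⁻ w in {w : Fin 2 → ℝ | 0 < w 1}, h (w 0) (w 1) := by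
            rw [← lintegral_indicator hT, lintegral_fin_two (hw.indicator hT)]
            simp only [← lintegral_indicator measurableSet_Ioi]
            rfl
      _ = _ := by
            rw [setLIntegral_herm2_params]
            refine congrArg _ (setLIntegral_congr_fun ?_ fun v hv => ?_)
            · simp only [Set.ofPred_and]
              exact .inter (measurableSet_lt (by fun_prop) (by fun_prop))
                (measurableSet_lt (by fun_prop) (by fun_prop))
            have e := orderedEigenvalue_herm2_of_interlacing hv
            simp only [hdef, cons_val_zero, cons_val_one, e]
            congr 4
            ring
  simp only [step]
  rw [lintegral_const_mul']
  · rw [lintegral_setLIntegral_swap]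
    · refine congrArg _ (lintegral_congr fun v => ?_)
      rw [setLIntegral_const, show {y | v 1 < y ∧ y < v 0} = Set.Ioo (v 1) (v 0) from rfl,
        Real.volume_Ioo, mul_comm, ← mul_assoc, ← sq]
    · simp only [Set.ofPred_and]
      exact .inter (measurableSet_lt (by fun_prop) (by fun_prop))
        (measurableSet_lt (by fun_prop) (by fun_prop))
    · simp only [Function.uncurry_def]
      fun_prop
  · exact ENNReal.ofReal_ne_top

/-- The Gaussian integral, over the first row `a, b`, of a function of the eigenvalues of a
bordered matrix. -/
noncomputable def borderIntegral (F : (Fin 3 → ℝ) → ℝ≥0∞) (x y : ℝ) (z : ℂ) : ℝ≥0∞ :=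
  ∫⁻ a : ℝ, ∫⁻ b : Fin 2 → ℂ, F (orderedEigenvalue (herm3 a b x y z)) *
    ENNReal.ofReal (Real.exp (-a ^ 2 / 2 - ∑ k, Complex.normSq (b k)))

/-- By unitary invariance of the Gaussian weight, the integral over the border depends only on the
eigenvalues of the bordered block. -/
theorem borderIntegral_eq_diagonal {F : (Fin 3 → ℝ) → ℝ≥0∞} (hF : Measurable F) (x y : ℝ)
    (z : ℂ) :
    borderIntegral F x y z = borderIntegral F (orderedEigenvalue (herm2 x y z) 0)
      (orderedEigenvalue (herm2 x y z) 1) 0 := by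
  obtain ⟨W, hW, hn, he⟩ := orderedEigenvalue_herm3_eq_diagonal x y z
  refine lintegral_congr fun a => ?_
  have hs : Measurable Complex.normSq := Complex.continuous_normSq.measurable
  refine Eq.trans ?_ ((measurePreserving_mulVec hW).lintegral_comp (by fun_prop))
  simp only [hn, ← he]

theorem measurable_borderIntegral {F : (Fin 3 → ℝ) → ℝ≥0∞} (hF : Measurable F) :
    Measurable fun u : Fin 2 → ℝ => borderIntegral F (u 0) (u 1) 0 := by
  have hs : Measurable Complex.normSq := Complex.continuous_normSq.measurable
  refine Measurable.lintegral_prod_right' (f := fun p : (Fin 2 → ℝ) × ℝ => ∫⁻ b : Fin 2 → ℂ,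
    F (orderedEigenvalue (herm3 p.2 b (p.1 0) (p.1 1) 0)) *
      ENNReal.ofReal (Real.exp (-p.2 ^ 2 / 2 - ∑ k, Complex.normSq (b k)))) ?_
  refine Measurable.lintegral_prod_right' (f := fun p : ((Fin 2 → ℝ) × ℝ) × (Fin 2 → ℂ) =>
    F (orderedEigenvalue (herm3 p.1.2 p.2 (p.1.1 0) (p.1.1 1) 0)) *
      ENNReal.ofReal (Real.exp (-p.1.2 ^ 2 / 2 - ∑ k, Complex.normSq (p.2 k)))) ?_
  fun_prop

/-- The integral over the border as an integral over the eigenvalues interlacing with those of the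
block. The exponent comes from `tr A² = a² + 2 ∑ |b k|² + x² + y²`. -/
theorem borderIntegral_diagonal {F : (Fin 3 → ℝ) → ℝ≥0∞} (hF : Measurable F) {x y : ℝ}
    (hxy : y < x) :
    borderIntegral F x y 0 = ENNReal.ofReal Real.pi ^ 2 *
      ∫⁻ v in {v : Fin 3 → ℝ | v 2 < y ∧ y < v 1 ∧ v 1 < x ∧ x < v 0},
        ENNReal.ofReal ((v 0 - v 1) * (v 1 - v 2) * (v 0 - v 2) / (x - y)) *
          (F v * ENNReal.ofReal
            (Real.exp (-(v 0 ^ 2 + v 1 ^ 2 + v 2 ^ 2 - x ^ 2 - y ^ 2) / 2))) := by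
  have hT : MeasurableSet {w : Fin 3 → ℝ | 0 < w 1 ∧ 0 < w 2} := by
    simp only [Set.ofPred_and]
    exact .inter (measurableSet_lt (by fun_prop) (by fun_prop))
      (measurableSet_lt (by fun_prop) (by fun_prop))
  let h : ℝ → ℝ → ℝ → ℝ≥0∞ := fun a s t =>
    F (orderedEigenvalue (herm3 a ![(√s : ℂ), (√t : ℂ)] x y 0)) *
      ENNReal.ofReal (Real.exp (-a ^ 2 / 2 - (s + t)))
  have hh : Measurable fun p : ℝ × ℝ × ℝ => h p.1 p.2.1 p.2.2 := by
    simp only [h]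
    fun_prop
  have hha : ∀ a, Measurable (Function.uncurry (h a)) := fun a => by
    simp only [h, Function.uncurry_def]
    fun_prop
  have hdef : ∀ a s t, h a s t = F (orderedEigenvalue (herm3 a ![(√s : ℂ), (√t : ℂ)] x y 0)) *
      ENNReal.ofReal (Real.exp (-a ^ 2 / 2 - (s + t))) := fun _ _ _ => rfl
  clear_value h
  have hw : Measurable fun w : Fin 3 → ℝ => h (w 0) (w 1) (w 2) :=
    hh.comp (by fun_prop : Measurable fun w : Fin 3 → ℝ => (w 0, w 1, w 2))
  calc _ = ∫⁻ a, ∫⁻ b : Fin 2 → ℂ, h a (Complex.normSq (b 0)) (Complex.normSq (b 1)) := by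
          simp only [hdef, ← orderedEigenvalue_herm3_diagonal_eq_sqrt_normSq, borderIntegral,
            Fin.sum_univ_two]
    _ = ∫⁻ a, ENNReal.ofReal Real.pi ^ 2 *
          ∫⁻ s in Set.Ioi 0, ∫⁻ t in Set.Ioi 0, h a s t :=
        lintegral_congr fun a => lintegral_comp_normSq_fin_two (hha a)
    _ = ENNReal.ofReal Real.pi ^ 2 * ∫⁻ a, ∫⁻ s in Set.Ioi 0, ∫⁻ t in Set.Ioi 0, h a s t :=
        lintegral_const_mul' _ _ (ENNReal.pow_ne_top ENNReal.ofReal_ne_top)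
    _ = ENNReal.ofReal Real.pi ^ 2 *
          ∫⁻ w in {w : Fin 3 → ℝ | 0 < w 1 ∧ 0 < w 2}, h (w 0) (w 1) (w 2) := by
        rw [← lintegral_indicator hT, lintegral_fin_three (hw.indicator hT)]
        simp only [← lintegral_indicator measurableSet_Ioi]
        refine congrArg _ (lintegral_congr fun a => lintegral_congr fun s => ?_)
        by_cases hs : 0 < s
        · rw [Set.indicator_of_mem (Set.mem_Ioi.2 hs)]
          refine lintegral_congr fun t => ?_
          by_cases ht : 0 < t
          · rw [Set.indicator_of_mem (Set.mem_Ioi.2 ht), Set.indicator_of_mem]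
            · rfl
            · exact ⟨hs, ht⟩
          · rw [Set.indicator_of_notMem (by simpa using ht), Set.indicator_of_notMem]
            exact fun hm => ht hm.2
        · rw [Set.indicator_of_notMem (by simpa using hs)]
          symm
          refine (lintegral_congr fun t => ?_).trans lintegral_zero
          rw [Set.indicator_of_notMem]
          exact fun hm => hs hm.1
    _ = _ := by
        rw [setLIntegral_herm3_params hxy]
        refine congrArg _ (setLIntegral_congr_fun ?_ fun v hv => ?_)
        · simp only [Set.ofPred_and]
          refine .inter ?_ (.inter ?_ (.inter ?_ ?_)) <;>
            exact measurableSet_lt (by fun_prop) (by fun_prop)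
        have hd : x - y ≠ 0 := (sub_pos.2 hxy).ne'
        have e := orderedEigenvalue_herm3_of_interlacing hv
        have e' : ![v 0 + v 1 + v 2 - x - y, (v 0 - x) * (x - v 1) * (x - v 2) / (x - y),
            (v 0 - y) * (v 1 - y) * (y - v 2) / (x - y)] 2 =
            (v 0 - y) * (v 1 - y) * (y - v 2) / (x - y) := rfl
        simp only [hdef, cons_val_zero, cons_val_one, e', e]
        congr 4
        field_simp
        ring

/-! ### Integrating out the eigenvalues of the block -/

theorem setLIntegral_Ioo_ofReal {f : ℝ → ℝ} (hf : Continuous f) {a b : ℝ} (hab : a ≤ b)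
    (h0 : ∀ x ∈ Set.Ioo a b, 0 ≤ f x) :
    ∫⁻ x in Set.Ioo a b, ENNReal.ofReal (f x) = ENNReal.ofReal (∫ x in a..b, f x) := by
  rw [intervalIntegral.integral_of_le hab, integral_Ioc_eq_integral_Ioo,
    ofReal_integral_eq_lintegral_ofReal]
  · exact (hf.integrableOn_Icc (a := a) (b := b)).mono_set Set.Ioo_subset_Icc_self
  · exact (ae_restrict_iff' measurableSet_Ioo).2 (.of_forall h0)

/-- Integrating the Vandermonde product of two variables over the points interlacing with `v` gives
half the Vandermonde product of `v`. -/
theorem setLIntegral_interlacing_vandermonde {v : Fin 3 → ℝ} (hv : v 2 < v 1 ∧ v 1 < v 0) :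
    ∫⁻ u in {u : Fin 2 → ℝ | v 2 < u 1 ∧ u 1 < v 1 ∧ v 1 < u 0 ∧ u 0 < v 0},
      ENNReal.ofReal (u 0 - u 1) =
        ENNReal.ofReal ((v 0 - v 1) * (v 1 - v 2) * (v 0 - v 2) / 2) := by
  have hS : MeasurableSet {u : Fin 2 → ℝ | v 2 < u 1 ∧ u 1 < v 1 ∧ v 1 < u 0 ∧ u 0 < v 0} := by
    simp only [Set.ofPred_and]
    refine .inter ?_ (.inter ?_ (.inter ?_ ?_)) <;>
      exact measurableSet_lt (by fun_prop) (by fun_prop)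
  rw [← lintegral_indicator hS, lintegral_fin_two (Measurable.indicator (by fun_prop) hS)]
  have hin : ∀ a ∈ Set.Ioo (v 1) (v 0),
      ∫⁻ b in Set.Ioo (v 2) (v 1), ENNReal.ofReal (a - b) =
        ENNReal.ofReal (a * (v 1 - v 2) - (v 1 ^ 2 - v 2 ^ 2) / 2) := by
    intro a ha
    rw [setLIntegral_Ioo_ofReal (by fun_prop) hv.1.le]
    · congr 1
      rw [intervalIntegral.integral_sub (by simp) (by simp)]
      simp
      ring
    · intro b hb
      linarith [ha.1, hb.2]
  calc _ = ∫⁻ a in Set.Ioo (v 1) (v 0), ∫⁻ b in Set.Ioo (v 2) (v 1), ENNReal.ofReal (a - b) := by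
        simp only [← lintegral_indicator measurableSet_Ioo]
        refine lintegral_congr fun a => ?_
        by_cases ha : a ∈ Set.Ioo (v 1) (v 0)
        · rw [Set.indicator_of_mem ha]
          refine lintegral_congr fun b => ?_
          by_cases hb : b ∈ Set.Ioo (v 2) (v 1)
          · rw [Set.indicator_of_mem hb, Set.indicator_of_mem]
            · rfl
            · exact ⟨hb.1, hb.2, ha.1, ha.2⟩
          · rw [Set.indicator_of_notMem hb, Set.indicator_of_notMem]
            exact fun hm => hb ⟨hm.1, hm.2.1⟩
        · rw [Set.indicator_of_notMem ha]
          refine (lintegral_congr fun b => ?_).trans lintegral_zero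
          rw [Set.indicator_of_notMem]
          exact fun hm => ha ⟨hm.2.2.1, hm.2.2.2⟩
    _ = _ := by
        rw [setLIntegral_congr_fun measurableSet_Ioo hin,
          setLIntegral_Ioo_ofReal (by fun_prop) hv.2.le]
        · congr 1
          rw [intervalIntegral.integral_sub ((by fun_prop : Continuous _).intervalIntegrable _ _)
            (by simp)]
          simp
          ring
        · intro a ha
          nlinarith [ha.1, hv.1]

/-- The joint density of the eigenvalues of a bordered matrix: the eigenvalues `u` of the block are
integrated out over the region where they interlace with `v`. -/
theorem lintegral_borderIntegral {F : (Fin 3 → ℝ) → ℝ≥0∞} (hF : Measurable F) :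
    ∫⁻ y : ℝ, ∫⁻ x : ℝ, ∫⁻ z : ℂ, borderIntegral F x y z *
        ENNReal.ofReal (Real.exp (-(x ^ 2 + y ^ 2) / 2 - Complex.normSq z)) =
      ENNReal.ofReal (Real.pi ^ 3 / 2) * ∫⁻ v in {v : Fin 3 → ℝ | v 2 < v 1 ∧ v 1 < v 0},
        ENNReal.ofReal (((v 0 - v 1) * (v 1 - v 2) * (v 0 - v 2)) ^ 2) *
          (F v * ENNReal.ofReal (Real.exp (-(v 0 ^ 2 + v 1 ^ 2 + v 2 ^ 2) / 2))) := by
  let D : (Fin 3 → ℝ) → ℝ := fun v => (v 0 - v 1) * (v 1 - v 2) * (v 0 - v 2)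
  let f : (Fin 3 → ℝ) → ℝ≥0∞ := fun v => ENNReal.ofReal (D v) *
    (F v * ENNReal.ofReal (Real.exp (-(v 0 ^ 2 + v 1 ^ 2 + v 2 ^ 2) / 2)))
  have hf : Measurable f := by
    simp only [f, D]
    fun_prop
  have hstep : ∀ u : Fin 2 → ℝ, ENNReal.ofReal (u 0 - u 1) ^ 2 *
      (borderIntegral F (u 0) (u 1) 0 *
        ENNReal.ofReal (Real.exp (-(u 0 ^ 2 + u 1 ^ 2) / 2))) =
      ENNReal.ofReal Real.pi ^ 2 *
        ∫⁻ v in {v : Fin 3 → ℝ | v 2 < u 1 ∧ u 1 < v 1 ∧ v 1 < u 0 ∧ u 0 < v 0},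
          ENNReal.ofReal (u 0 - u 1) * f v := by
    intro u
    rcases lt_or_ge (u 1) (u 0) with h | h
    · have hd : 0 < u 0 - u 1 := sub_pos.2 h
      rw [borderIntegral_diagonal hF h, mul_assoc (ENNReal.ofReal Real.pi ^ 2), mul_left_comm,
        ← lintegral_mul_const' _ _ ENNReal.ofReal_ne_top,
        ← lintegral_const_mul' _ _ (ENNReal.pow_ne_top ENNReal.ofReal_ne_top)]
      refine congrArg _ (lintegral_congr fun v => ?_)
      have e1 : ENNReal.ofReal (u 0 - u 1) ^ 2 * ENNReal.ofReal (D v / (u 0 - u 1)) =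
          ENNReal.ofReal (u 0 - u 1) * ENNReal.ofReal (D v) := by
        rw [← ENNReal.ofReal_pow hd.le, ← ENNReal.ofReal_mul (by positivity),
          ← ENNReal.ofReal_mul hd.le]
        congr 1
        field_simp
      have e2 : ENNReal.ofReal (Real.exp (-(v 0 ^ 2 + v 1 ^ 2 + v 2 ^ 2 - u 0 ^ 2 - u 1 ^ 2) / 2))
          * ENNReal.ofReal (Real.exp (-(u 0 ^ 2 + u 1 ^ 2) / 2)) =
          ENNReal.ofReal (Real.exp (-(v 0 ^ 2 + v 1 ^ 2 + v 2 ^ 2) / 2)) := by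
        rw [← ENNReal.ofReal_mul (Real.exp_pos _).le, ← Real.exp_add]
        congr 2
        ring
      simp only [f]
      rw [← e2, ← mul_assoc (ENNReal.ofReal (u 0 - u 1)), ← e1]
      simp only [D]
      ring
    · rw [ENNReal.ofReal_of_nonpos (sub_nonpos.2 h)]
      simp
  rw [lintegral_congr fun y => lintegral_congr fun x => lintegral_congr fun z =>
    congrArg (· * _) (borderIntegral_eq_diagonal hF x y z)]
  rw [lintegral_herm2 (measurable_borderIntegral hF), lintegral_congr hstep,
    lintegral_const_mul' _ _ (ENNReal.pow_ne_top ENNReal.ofReal_ne_top),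
    lintegral_setLIntegral_swap, ← mul_assoc]
  · have hT : MeasurableSet {v : Fin 3 → ℝ | v 2 < v 1 ∧ v 1 < v 0} := by
      simp only [Set.ofPred_and]
      exact .inter (measurableSet_lt (by fun_prop) (by fun_prop))
        (measurableSet_lt (by fun_prop) (by fun_prop))
    have hc : ENNReal.ofReal Real.pi * ENNReal.ofReal Real.pi ^ 2 = ENNReal.ofReal 2 *
        ENNReal.ofReal (Real.pi ^ 3 / 2) := by
      rw [← ENNReal.ofReal_pow Real.pi_pos.le, ← ENNReal.ofReal_mul Real.pi_pos.le,
        ← ENNReal.ofReal_mul zero_le_two]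
      congr 1
      ring
    rw [hc, mul_comm (ENNReal.ofReal 2), mul_assoc,
      ← lintegral_const_mul' _ _ ENNReal.ofReal_ne_top, ← lintegral_indicator hT]
    refine congrArg _ (lintegral_congr fun v => ?_)
    by_cases hv : v 2 < v 1 ∧ v 1 < v 0
    · have hD : 0 < D v := mul_pos (mul_pos (sub_pos.2 hv.2) (sub_pos.2 hv.1))
        (sub_pos.2 (hv.1.trans hv.2))
      rw [Set.indicator_of_mem (by exact hv), lintegral_mul_const _ (by fun_prop),
        setLIntegral_interlacing_vandermonde hv]
      simp only [f]
      rw [← mul_assoc, ← mul_assoc, ← ENNReal.ofReal_mul zero_le_two,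
        ← ENNReal.ofReal_mul (by positivity)]
      congr 2
      simp only [D]
      ring
    · rw [Set.indicator_of_notMem (by exact hv)]
      have : {u : Fin 2 → ℝ | v 2 < u 1 ∧ u 1 < v 1 ∧ v 1 < u 0 ∧ u 0 < v 0} = ∅ :=
        Set.eq_empty_of_forall_notMem fun u hu =>
          hv ⟨hu.1.trans hu.2.1, hu.2.2.1.trans hu.2.2.2⟩
      rw [this]
      simp
  · simp only [Set.ofPred_and]
    refine .inter ?_ (.inter ?_ (.inter ?_ ?_)) <;>
      exact measurableSet_lt (by fun_prop) (by fun_prop)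
  · simp only [Function.uncurry_def]
    fun_prop

/-! ### The Gaussian unitary ensemble in Lebesgue coordinates -/

theorem lintegral_gaussianReal_zero_one (f : ℝ → ℝ≥0∞) :
    ∫⁻ x, f x ∂gaussianReal 0 1 = ENNReal.ofReal (√(2 * Real.pi))⁻¹ *
      ∫⁻ x, f x * ENNReal.ofReal (Real.exp (-x ^ 2 / 2)) := by
  rw [gaussianReal_of_var_ne_zero _ one_ne_zero,
    lintegral_withDensity_eq_lintegral_mul_non_measurable _ (measurable_gaussianPDF _ _)
      (.of_forall fun _ => gaussianPDF_lt_top),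
    ← lintegral_const_mul' _ _ ENNReal.ofReal_ne_top]
  refine lintegral_congr fun x => ?_
  simp only [Pi.mul_apply, gaussianPDF, gaussianPDFReal, NNReal.coe_one, mul_one, sub_zero]
  rw [ENNReal.ofReal_mul (by positivity), mul_assoc, mul_comm (f x)]

/-- The standard complex Gaussian measure: real and imaginary parts are independent `N(0, 1/2)`. -/
noncomputable def complexGaussian : Measure ℂ :=
  ((gaussianReal 0 (1 / 2)).prod (gaussianReal 0 (1 / 2))).map Complex.measurableEquivRealProd.symm

instance : IsProbabilityMeasure complexGaussian :=
  Measure.isProbabilityMeasure_map Complex.measurableEquivRealProd.symm.measurable.aemeasurable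

theorem lintegral_complexGaussian (f : ℂ → ℝ≥0∞) :
    ∫⁻ z, f z ∂complexGaussian = ENNReal.ofReal Real.pi⁻¹ *
      ∫⁻ z, f z * ENNReal.ofReal (Real.exp (-Complex.normSq z)) := by
  rw [complexGaussian, lintegral_map_equiv, gaussianReal_of_var_ne_zero _ (by norm_num),
    prod_withDensity (measurable_gaussianPDF _ _) (measurable_gaussianPDF _ _),
    lintegral_withDensity_eq_lintegral_mul_non_measurable _
      (f := fun p : ℝ × ℝ => gaussianPDF 0 (1 / 2) p.1 * gaussianPDF 0 (1 / 2) p.2)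
      (((measurable_gaussianPDF _ _).comp measurable_fst).mul
        ((measurable_gaussianPDF _ _).comp measurable_snd))
      (.of_forall fun _ => ENNReal.mul_lt_top gaussianPDF_lt_top gaussianPDF_lt_top),
    ← Complex.volume_preserving_equiv_real_prod.symm.lintegral_comp_emb
      Complex.measurableEquivRealProd.symm.measurableEmbedding,
    ← lintegral_const_mul' _ _ ENNReal.ofReal_ne_top, Measure.volume_eq_prod]
  refine lintegral_congr fun p => ?_
  simp only [Pi.mul_apply, gaussianPDF, gaussianPDFReal, sub_zero]
  rw [← ENNReal.ofReal_mul (by positivity), mul_comm (f _), ← mul_assoc (ENNReal.ofReal _),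
    ← ENNReal.ofReal_mul (by positivity)]
  congr 2
  have h1 : 2 * Real.pi * ((1 / 2 : NNReal) : ℝ) = Real.pi := by push_cast; ring
  have h2 : 2 * ((1 / 2 : NNReal) : ℝ) = 1 := by push_cast; ring
  rw [h1, h2, mul_mul_mul_comm, ← Real.exp_add, ← mul_inv, Real.mul_self_sqrt Real.pi_pos.le]
  congr 2
  simp [Complex.normSq_apply, Complex.measurableEquivRealProd_symm_apply]
  ring

/-- The nine real parameters of the bordered matrix `herm3 a b x y z`. -/
def borderedParams (p : ℝ × ℝ × ℂ × ℝ × ℂ × ℂ) : Fin 3 × Fin 3 → ℝ := fun ij =>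
  !![p.2.2.2.1, p.2.2.2.2.1.re, p.2.2.2.2.2.re;
    p.2.2.2.2.1.im, p.2.1, p.2.2.1.re;
    p.2.2.2.2.2.im, p.2.2.1.im, p.1] ij.1 ij.2

theorem hermitianOfParams_borderedParams (p : ℝ × ℝ × ℂ × ℝ × ℂ × ℂ) :
    (⟨hermitianOfParams (borderedParams p), isHermitian_hermitianOfParams _⟩ : HermitianMatrix 3) =
      herm3 p.2.2.2.1 ![p.2.2.2.2.1, p.2.2.2.2.2] p.2.1 p.1 p.2.2.1 := by
  apply Subtype.ext
  ext i j
  fin_cases i <;> fin_cases j <;>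
    simp [herm3, hermitianOfParams, borderedParams, Complex.ext_iff]

theorem complexGaussian_reProdIm (s t : Set ℝ) :
    complexGaussian (s ×ℂ t) = gaussianReal 0 (1 / 2) s * gaussianReal 0 (1 / 2) t := by
  rw [complexGaussian, MeasurableEquiv.map_apply, ← Measure.prod_prod]
  rfl

theorem measurable_borderedParams : Measurable borderedParams := by
  have hr := Complex.measurable_re
  have hi := Complex.measurable_im
  refine measurable_pi_lambda _ fun ij => ?_
  obtain ⟨i, j⟩ := ij
  fin_cases i <;> fin_cases j <;> simp [borderedParams] <;> fun_prop

theorem measurePreserving_borderedParams :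
    MeasurePreserving borderedParams
      ((gaussianReal 0 1).prod ((gaussianReal 0 1).prod (complexGaussian.prod
        ((gaussianReal 0 1).prod (complexGaussian.prod complexGaussian)))))
      (Measure.pi fun p : Fin 3 × Fin 3 => gaussianReal 0 (if p.1 = p.2 then 1 else 1 / 2)) := by
  refine ⟨measurable_borderedParams, (Measure.pi_eq fun s hs => ?_).symm⟩
  have h : borderedParams ⁻¹' Set.univ.pi s = s (2, 2) ×ˢ s (1, 1) ×ˢ (s (1, 2) ×ℂ s (2, 1)) ×ˢ
      s (0, 0) ×ˢ (s (0, 1) ×ℂ s (1, 0)) ×ˢ (s (0, 2) ×ℂ s (2, 0)) := by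
    ext p
    simp [borderedParams, Prod.forall, Fin.forall_fin_succ, Complex.mem_reProdIm]
    tauto
  rw [Measure.map_apply measurable_borderedParams (.univ_pi hs), h]
  simp only [Measure.prod_prod, complexGaussian_reProdIm, Fintype.prod_prod_type,
    Fin.prod_univ_three]
  simp
  ring

/-- The `3 × 3` GUE, with the Lebesgue density of its entries made explicit. -/
theorem lintegral_gue_three {F : (Fin 3 → ℝ) → ℝ≥0∞} (hF : Measurable F) :
    ∫⁻ A, F (orderedEigenvalue A) ∂gue 3 =
      ENNReal.ofReal ((√(2 * Real.pi))⁻¹ ^ 3 * Real.pi⁻¹ ^ 3) *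
      ∫⁻ y : ℝ, ∫⁻ x : ℝ, ∫⁻ z : ℂ, borderIntegral F x y z *
        ENNReal.ofReal (Real.exp (-(x ^ 2 + y ^ 2) / 2 - Complex.normSq z)) := by
  have hF' : Measurable fun A : HermitianMatrix 3 => F (orderedEigenvalue A) :=
    hF.comp (measurable_orderedEigenvalue 3)
  have hG : Measurable fun p : ℝ × ℝ × ℂ × ℝ × ℂ × ℂ =>
      F (orderedEigenvalue (herm3 p.2.2.2.1 ![p.2.2.2.2.1, p.2.2.2.2.2] p.2.1 p.1 p.2.2.1)) := by
    fun_prop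
  have hn : Measurable Complex.normSq := Complex.continuous_normSq.measurable
  rw [gue, lintegral_map hF' (measurable_hermitianOfParams 3)]
  refine (measurePreserving_borderedParams.lintegral_comp
    (hF'.comp (measurable_hermitianOfParams 3))).symm.trans ?_
  simp only [Function.comp_def]
  simp only [hermitianOfParams_borderedParams]
  rw [lintegral_prod _ hG.aemeasurable]
  have e1 : ∀ y, Measurable fun p : ℝ × ℂ × ℝ × ℂ × ℂ =>
      F (orderedEigenvalue (herm3 p.2.2.1 ![p.2.2.2.1, p.2.2.2.2] p.1 y p.2.1)) := fun y => by
    fun_prop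
  have e2 : ∀ y x, Measurable fun p : ℂ × ℝ × ℂ × ℂ =>
      F (orderedEigenvalue (herm3 p.2.1 ![p.2.2.1, p.2.2.2] x y p.1)) := fun y x => by
    fun_prop
  have e3 : ∀ y x z, Measurable fun p : ℝ × ℂ × ℂ =>
      F (orderedEigenvalue (herm3 p.1 ![p.2.1, p.2.2] x y z)) := fun y x z => by
    fun_prop
  have e4 : ∀ y x z a, Measurable fun p : ℂ × ℂ =>
      F (orderedEigenvalue (herm3 a ![p.1, p.2] x y z)) := fun y x z a => by
    fun_prop
  have e5 : ∀ y x z a, Measurable fun b : Fin 2 → ℂ =>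
      F (orderedEigenvalue (herm3 a b x y z)) *
        ENNReal.ofReal (Real.exp (-a ^ 2 / 2 - ∑ k, Complex.normSq (b k))) := fun y x z a => by
    fun_prop
  refine (lintegral_congr fun y => (lintegral_prod _ (e1 y).aemeasurable).trans <|
    lintegral_congr fun x => (lintegral_prod _ (e2 y x).aemeasurable).trans <|
    lintegral_congr fun z => (lintegral_prod _ (e3 y x z).aemeasurable).trans <|
    lintegral_congr fun a => lintegral_prod _ (e4 y x z a).aemeasurable).trans ?_
  simp only [borderIntegral, fun y x z a => lintegral_fin_two (e5 y x z a),
    lintegral_gaussianReal_zero_one, lintegral_complexGaussian]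
  have hexp : ∀ y x z a (b c : ℂ),
      ENNReal.ofReal (Real.exp (-a ^ 2 / 2 - ∑ k, Complex.normSq (![b, c] k))) *
        ENNReal.ofReal (Real.exp (-(x ^ 2 + y ^ 2) / 2 - Complex.normSq z)) =
      ENNReal.ofReal (Real.exp (-Complex.normSq c)) *
      ENNReal.ofReal (Real.exp (-Complex.normSq b)) * ENNReal.ofReal (Real.exp (-a ^ 2 / 2)) *
      ENNReal.ofReal (Real.exp (-Complex.normSq z)) * ENNReal.ofReal (Real.exp (-x ^ 2 / 2)) *
      ENNReal.ofReal (Real.exp (-y ^ 2 / 2)) := by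
    intro y x z a b c
    simp only [← ENNReal.ofReal_mul (Real.exp_pos _).le, ← Real.exp_add]
    congr 2
    rw [Fin.sum_univ_two]
    simp only [cons_val_zero, cons_val_one]
    ring
  simp only [← lintegral_const_mul' _ _ (ENNReal.ofReal_ne_top : ENNReal.ofReal _ ≠ ⊤),
    ← lintegral_mul_const' _ _ (ENNReal.ofReal_ne_top : ENNReal.ofReal _ ≠ ⊤)]
  refine lintegral_congr fun y => lintegral_congr fun x => lintegral_congr fun z =>
    lintegral_congr fun a => lintegral_congr fun b => lintegral_congr fun c => ?_
  rw [mul_assoc (F _), hexp, ENNReal.ofReal_mul (by positivity), ENNReal.ofReal_pow (by positivity),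
    ENNReal.ofReal_pow (by positivity)]
  ring

/-! ### Spacings -/

/-- The coordinates are the largest entry `a` and the two consecutive spacings `α, β`. -/
theorem lintegral_fin_three_eq_spacings {f : (Fin 3 → ℝ) → ℝ≥0∞} (hf : Measurable f) :
    ∫⁻ v, f v = ∫⁻ α, ∫⁻ β, ∫⁻ a, f ![a, a - α, a - α - β] := by
  calc _ = ∫⁻ a, ∫⁻ α, ∫⁻ β, f ![a, a - α, a - α - β] := by
        rw [lintegral_fin_three hf]
        refine lintegral_congr fun a => ?_
        rw [← lintegral_sub_left_eq_self _ a]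
        refine lintegral_congr fun α => ?_
        rw [← lintegral_sub_left_eq_self _ (a - α)]
    _ = ∫⁻ α, ∫⁻ a, ∫⁻ β, f ![a, a - α, a - α - β] := by
        refine lintegral_lintegral_swap (Measurable.aemeasurable ?_)
        exact Measurable.lintegral_prod_right' (f := fun p : (ℝ × ℝ) × ℝ =>
          f ![p.1.1, p.1.1 - p.1.2, p.1.1 - p.1.2 - p.2]) (by fun_prop)
    _ = _ := by
        refine lintegral_congr fun α => lintegral_lintegral_swap (Measurable.aemeasurable ?_)
        simp only [Function.uncurry_def]
        fun_prop

/-- Integrating out the position of the spectrum, by completing the square in `a`. -/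
theorem lintegral_exp_sum_sq (α β : ℝ) :
    ∫⁻ a : ℝ, ENNReal.ofReal (Real.exp (-(a ^ 2 + (a - α) ^ 2 + (a - α - β) ^ 2) / 2)) =
      ENNReal.ofReal (√(2 * Real.pi / 3) *
        Real.exp (-(1 / 3) * (α ^ 2 + α * β + β ^ 2))) := by
  have h : ∀ a : ℝ, Real.exp (-(a ^ 2 + (a - α) ^ 2 + (a - α - β) ^ 2) / 2) =
      Real.exp (-(3 / 2) * (a - (2 * α + β) / 3) ^ 2) *
        Real.exp (-(1 / 3) * (α ^ 2 + α * β + β ^ 2)) := fun a => by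
    rw [← Real.exp_add]
    congr 1
    ring
  simp only [h, ENNReal.ofReal_mul (Real.exp_pos _).le]
  rw [lintegral_mul_const' _ _ ENNReal.ofReal_ne_top,
    lintegral_sub_right_eq_self (fun a => ENNReal.ofReal (Real.exp (-(3 / 2) * a ^ 2))),
    ← ofReal_integral_eq_lintegral_ofReal (integrable_exp_neg_mul_sq (by norm_num))
      (.of_forall fun _ => (Real.exp_pos _).le), integral_gaussian,
    ← ENNReal.ofReal_mul (Real.sqrt_nonneg _)]
  congr 3
  ring

theorem spacing_constant_eq :
    (√(2 * Real.pi))⁻¹ ^ 3 * Real.pi⁻¹ ^ 3 * (Real.pi ^ 3 / 2) * √(2 * Real.pi / 3) =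
      (4 * Real.pi * √3)⁻¹ := by
  have h2 : √(2 * Real.pi) ^ 2 = 2 * Real.pi := Real.sq_sqrt (by positivity)
  have hpi := Real.pi_pos
  have h3 : 0 < √(2 * Real.pi) := Real.sqrt_pos.2 (by positivity)
  rw [Real.sqrt_div (by positivity)]
  field_simp
  rw [h2]
  ring

theorem abs_spacing_constant_sub_lt : |(4 * Real.pi * √3)⁻¹ - 0.046| < 0.0005 := by
  have hp := Real.pi_gt_d2
  have hp' := Real.pi_lt_d2
  have h3 : 1.73 < √3 := Real.lt_sqrt_of_sq_lt (by norm_num)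
  have h3' : √3 < 1.74 := (Real.sqrt_lt' (by norm_num)).2 (by norm_num)
  have hpos : 0 < 4 * Real.pi * √3 := by positivity
  rw [abs_sub_lt_iff, sub_lt_iff_lt_add, sub_lt_comm]
  constructor
  · rw [inv_lt_comm₀ hpos (by norm_num)]
    nlinarith
  · rw [lt_inv_comm₀ (by norm_num) hpos]
    nlinarith

theorem lintegral_gue_three_spacings {f : ℝ × ℝ → ℝ≥0∞} (hf : Measurable f) :
    ∫⁻ A, f (orderedEigenvalue A 0 - orderedEigenvalue A 1,
        orderedEigenvalue A 1 - orderedEigenvalue A 2) ∂gue 3 =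
      ∫⁻ p in {p : ℝ × ℝ | 0 ≤ p.1 ∧ 0 ≤ p.2},
        ENNReal.ofReal ((4 * Real.pi * √3)⁻¹ * p.1 ^ 2 * p.2 ^ 2 * (p.1 + p.2) ^ 2 *
          Real.exp (-(1 / 3) * (p.1 ^ 2 + p.1 * p.2 + p.2 ^ 2))) * f p := by
  have hT : MeasurableSet {v : Fin 3 → ℝ | v 2 < v 1 ∧ v 1 < v 0} := by
    simp only [Set.ofPred_and]
    exact .inter (measurableSet_lt (by fun_prop) (by fun_prop))
      (measurableSet_lt (by fun_prop) (by fun_prop))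
  have hQ : MeasurableSet {p : ℝ × ℝ | 0 ≤ p.1 ∧ 0 ≤ p.2} := by
    simp only [Set.ofPred_and]
    exact .inter (measurableSet_le (by fun_prop) (by fun_prop))
      (measurableSet_le (by fun_prop) (by fun_prop))
  have hF : Measurable fun v : Fin 3 → ℝ => f (v 0 - v 1, v 1 - v 2) := by fun_prop
  rw [lintegral_gue_three hF, lintegral_borderIntegral hF, ← mul_assoc,
    ← ENNReal.ofReal_mul (by positivity), ← lintegral_indicator hT, ← lintegral_indicator hQ,
    lintegral_fin_three_eq_spacings (Measurable.indicator (by fun_prop) hT),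
    Measure.volume_eq_prod, lintegral_prod _ (Measurable.indicator (by fun_prop) hQ).aemeasurable]
  simp only [← lintegral_const_mul' _ _ (ENNReal.ofReal_ne_top : ENNReal.ofReal _ ≠ ⊤)]
  refine lintegral_congr fun α => lintegral_congr fun β => ?_
  rw [lintegral_const_mul' _ _ ENNReal.ofReal_ne_top]
  by_cases h : 0 < α ∧ 0 < β
  · obtain ⟨hα, hβ⟩ := h
    rw [Set.indicator_of_mem (by exact ⟨hα.le, hβ.le⟩)]
    have e : ∀ a : ℝ, ({v : Fin 3 → ℝ | v 2 < v 1 ∧ v 1 < v 0}.indicator (fun v =>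
        ENNReal.ofReal (((v 0 - v 1) * (v 1 - v 2) * (v 0 - v 2)) ^ 2) *
          (f (v 0 - v 1, v 1 - v 2) *
            ENNReal.ofReal (Real.exp (-(v 0 ^ 2 + v 1 ^ 2 + v 2 ^ 2) / 2))))
        ![a, a - α, a - α - β]) =
        ENNReal.ofReal (α ^ 2 * β ^ 2 * (α + β) ^ 2) * f (α, β) *
          ENNReal.ofReal (Real.exp (-(a ^ 2 + (a - α) ^ 2 + (a - α - β) ^ 2) / 2)) := by
      intro a
      rw [Set.indicator_of_mem]
      · have h0 : ![a, a - α, a - α - β] 0 = a := rfl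
        have h1 : ![a, a - α, a - α - β] 1 = a - α := rfl
        have h2 : ![a, a - α, a - α - β] 2 = a - α - β := rfl
        rw [h0, h1, h2, ← mul_assoc, sub_sub_cancel, sub_sub_cancel,
          show a - (a - α - β) = α + β by ring, mul_pow, mul_pow]
      · exact ⟨sub_lt_self _ hβ, sub_lt_self _ hα⟩
    simp only [e]
    rw [lintegral_const_mul _ (by fun_prop), lintegral_exp_sum_sq, mul_right_comm _ (f _),
      ← ENNReal.ofReal_mul (by positivity), ← mul_assoc, ← ENNReal.ofReal_mul (by positivity),
      ← spacing_constant_eq]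
    congr 2
    ring
  · have e : ∀ a : ℝ, ![a, a - α, a - α - β] ∉ {v : Fin 3 → ℝ | v 2 < v 1 ∧ v 1 < v 0} :=
      fun a ha => h ⟨by simpa using ha.2, by simpa using ha.1⟩
    simp only [Set.indicator_of_notMem (e _), lintegral_zero, mul_zero]
    by_cases hq : 0 ≤ α ∧ 0 ≤ β
    -- On the boundary of the quadrant the density vanishes.
    · rw [Set.indicator_of_mem (by exact hq)]
      have : α = 0 ∨ β = 0 := by
        by_contra! h0
        exact h ⟨hq.1.lt_of_ne' h0.1, hq.2.lt_of_ne' h0.2⟩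
      rcases this with rfl | rfl <;> simp
    · rw [Set.indicator_of_notMem (by exact hq)]

end

theorem mainTheorem1 :
    ∃ C : ℝ, |C - 0.046| < 0.0005 ∧
      ∀ {Ω : Type*} [MeasurableSpace Ω] (P : Measure Ω) (H : Ω → HermitianMatrix 3),
        HasLaw H (gue 3) P →
        HasLaw
          (fun ω => (orderedEigenvalue (H ω) 0 - orderedEigenvalue (H ω) 1,
            orderedEigenvalue (H ω) 1 - orderedEigenvalue (H ω) 2))
          (((volume : Measure (ℝ × ℝ)).restrict {p | 0 ≤ p.1 ∧ 0 ≤ p.2}).withDensity fun p =>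
            ENNReal.ofReal (C * p.1 ^ 2 * p.2 ^ 2 * (p.1 + p.2) ^ 2 *
              Real.exp (-(1 / 3) * (p.1 ^ 2 + p.1 * p.2 + p.2 ^ 2))))
          P := by
  refine ⟨(4 * Real.pi * √3)⁻¹, abs_spacing_constant_sub_lt, fun P H hH => ?_⟩
  have hk : ∀ k, Measurable fun A : HermitianMatrix 3 => orderedEigenvalue A k := fun k =>
    (measurable_pi_apply k).comp (measurable_orderedEigenvalue 3)
  have hm : Measurable fun A : HermitianMatrix 3 => (orderedEigenvalue A 0 - orderedEigenvalue A 1,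
      orderedEigenvalue A 1 - orderedEigenvalue A 2) :=
    ((hk 0).sub (hk 1)).prodMk ((hk 1).sub (hk 2))
  refine HasLaw.fun_comp (Y := fun A : HermitianMatrix 3 =>
    (orderedEigenvalue A 0 - orderedEigenvalue A 1,
      orderedEigenvalue A 1 - orderedEigenvalue A 2)) ⟨hm.aemeasurable, ?_⟩ hH
  refine Measure.ext_of_lintegral _ fun f hf => ?_
  rw [lintegral_map hf hm, lintegral_gue_three_spacings hf,
    lintegral_withDensity_eq_lintegral_mul _ (by fun_prop) hf]
  rfl
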